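/- Let $k \ge 1$ be an integer, let $m = 4k+3$ or $m = 4k+5$, and let $\theta = 2\pi/m$. Let $P$ be a finite set of points in the plane and let $S$ be a set of line segments (constraints) between points of $P$, no two of which intersect properly. Two points $u, v \in P$ see each other if the segment $uv$ does not properly intersect any constraint or is itself a constraint; $\mathrm{Vis}(P,S)$ is the graph on $P$ whose edges are the segments between distinct points that see each other, weighted by Euclidean length. Around each $u \in P$, split the plane into $m$ cones of aperture $\theta$ with apex $u$, oriented so that the bisector of one of them points vertically upwards. Assume general position: no two points of $P$ lie on a line parallel to a ray bounding a cone, no two lie on a line perpendicular to the bisector of a cone, and no three points are collinear. The lines through the constraints $uv$ with $v$ in a cone $C$ of $u$ split $C$ into closed subcones (so $v$ lies in both of the subcones adjacent to $uv$; a cone that is not split is a single subcone). The constrained $\theta$-graph with $m$ cones is the graph on $P$ that has, for each $u \in P$ and each subcone of a cone $C$ of $u$, an edge from $u$ to the point of $P \setminus \{u\}$ in that subcone which sees $u$ and is closest to $u$ (if there is such a point), where the distance from $u$ to $v$ is measured as the length of the projection of $uv$ on the bisector of $C$. Then the constrained $\theta$-graph with $m$ cones is a $t$-spanner of $\mathrm{Vis}(P,S)$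 for $$t = \frac{\cos(\theta/4)}{\cos(\theta/2) - \sin(3\theta/4)} ,$$ that is, $t \ge 1$, it is a subgraph of $\mathrm{Vis}(P,S)$, and for all $u, v \in P$ the length of a shortest path from $u$ to $v$ in it is at most $t$ times the length of a shortest path from $u$ to $v$ in $\mathrm{Vis}(P,S)$. -/

import Mathlib

open scoped ENNReal

noncomputable section

namespace ConstrainedTheta

/-- The Euclidean plane. -/
abbrev Plane := EuclideanSpace ℝ (Fin 2)

/-- The unit vector obtained from the upward vertical by a clockwise rotation by `φ`. -/
def dir (φ : ℝ) : Plane := !₂[Real.sin φ, Real.cos φ]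

/-- The aperture `θ = 2π / m` of the cones. -/
def aperture (m : ℕ) : ℝ := 2 * Real.pi / m

/-- Direction of the bisector of the `i`-th cone: the cones are numbered clockwise and the bisector
of the `0`-th cone points vertically upwards. -/
def bisectorDir (m i : ℕ) : Plane := dir (i * aperture m)

/-- Direction of the ray that bounds the `i`-th cone on its counterclockwise side; the other ray of
that cone has direction `rayDir m (i + 1)`. -/
def rayDir (m i : ℕ) : Plane := dir ((i - 1 / 2 : ℝ) * aperture m)

/-- The `i`-th cone with apex `u`: the region between two consecutive rays. -/
def cone (m : ℕ) (u : Plane) (i : ℕ) : Set Plane :=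
  {x | ∃ s t : ℝ, 0 ≤ s ∧ 0 ≤ t ∧ x = u + (s • rayDir m i + t • rayDir m (i + 1))}

/-- The orthogonal projection of `x` on the line through `u` that carries the bisector of the `i`-th
cone of `u`. -/
def bisectorProj (m : ℕ) (u : Plane) (i : ℕ) (x : Plane) : Plane :=
  u + inner ℝ (bisectorDir m i) (x - u) • bisectorDir m i

/-- Twice the signed area of the triangle `p q x`: it is zero exactly if `x` lies on the line through
`p` and `q` (for `p ≠ q`), and its sign tells on which side of this line `x` lies. -/
def side (p q x : Plane) : ℝ :=
  (q 0 - p 0) * (x 1 - p 1) - (q 1 - p 1) * (x 0 - p 0)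

/-- The segments `ab` and `cd` intersect properly: their interiors meet in exactly one point. -/
def ProperlyIntersect (a b c d : Plane) : Prop :=
  ∃ p, openSegment ℝ a b ∩ openSegment ℝ c d = {p}

variable {P : Finset Plane}

/-- A set of line segments between distinct points of `P` is a simple graph `S` on `P`. It is planar
if no two of the segments intersect properly. -/
def PlanarConstraints (S : SimpleGraph P) : Prop :=
  ∀ a b c d : P, S.Adj a b → S.Adj c d → ¬ ProperlyIntersect a b c d

/-- General position with respect to the `m` cones. -/
structure GeneralPosition (m : ℕ) (P : Finset Plane) : Prop where
  not_parallel_ray : ∀ u ∈ P, ∀ v ∈ P, u ≠ v → ∀ i : Fin m, ∀ t : ℝ, v - u ≠ t • rayDir m i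
  not_perp_bisector : ∀ u ∈ P, ∀ v ∈ P, u ≠ v → ∀ i : Fin m,
    inner ℝ (bisectorDir m i) (v - u) ≠ 0
  not_collinear : ∀ u ∈ P, ∀ v ∈ P, ∀ w ∈ P, u ≠ v → u ≠ w → v ≠ w →
    ¬ Collinear ℝ ({u, v, w} : Set Plane)

/-- The visibility graph of `P` with respect to the constraints `S`. -/
def visGraph (S : SimpleGraph P) : SimpleGraph P where
  Adj u v := u ≠ v ∧
    (S.Adj u v ∨ ∀ a b : P, S.Adj a b → ¬ ProperlyIntersect u v a b)
  symm := ⟨by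
    rintro u v ⟨hne, h⟩
    refine ⟨hne.symm, h.imp (fun h => h.symm) (fun h a b hab => ?_)⟩
    have := h a b hab
    unfold ProperlyIntersect at this ⊢
    rwa [openSegment_symm ℝ (v : Plane) (u : Plane)]⟩
  loopless := ⟨fun _ h => h.1 rfl⟩

/-- `K` is a subcone of the `i`-th cone of `u`: the lines through the constraints `uz` with `z` in that
cone split the cone, and `K` is the closed piece that contains a given point `x` of the cone which is
on none of these lines. (If there is no such constraint, `K` is the whole cone; the other endpoint of
a constraint that splits the cone lies in both adjacent pieces.) -/
def IsSubcone (m : ℕ) (S : SimpleGraph P) (u : P) (i : ℕ) (K : Set Plane) : Prop :=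
  ∃ x ∈ cone m u i,
    (∀ z : P, S.Adj u z → (z : Plane) ∈ cone m u i → side u z x ≠ 0) ∧
    K = {y | y ∈ cone m u i ∧
      ∀ z : P, S.Adj u z → (z : Plane) ∈ cone m u i → 0 ≤ side u z x * side u z y}

/-- `u` adds an edge to `v`: in some subcone of `u`, `v` is visible from `u` and closest to `u` among
the visible vertices of the subcone, distances being measured along the bisector of the cone. -/
def AddsEdge (m : ℕ) (S : SimpleGraph P) (u v : P) : Prop :=
  ∃ (i : Fin m) (K : Set Plane), IsSubcone m S u i K ∧
    (visGraph S).Adj u v ∧ (v : Plane) ∈ K ∧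
    ∀ w : P, (visGraph S).Adj u w → (w : Plane) ∈ K →
      dist (u : Plane) (bisectorProj m u i v) ≤ dist (u : Plane) (bisectorProj m u i w)

/-- The constrained `θ`-graph with `m` cones. -/
def thetaGraph (m : ℕ) (S : SimpleGraph P) : SimpleGraph P :=
  SimpleGraph.fromRel (AddsEdge m S)

/-- The Euclidean length of a walk. -/
def walkLength {G : SimpleGraph P} {u v : P} (p : G.Walk u v) : ℝ≥0∞ :=
  (p.darts.map fun e => edist (e.fst : Plane) (e.snd : Plane)).sum

/-- The weighted graph distance, with value `∞` if there is no path. -/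
def graphDist (G : SimpleGraph P) (u v : P) : ℝ≥0∞ :=
  ⨅ p : G.Walk u v, walkLength p

/-- `H` is a `t`-spanner of `G`. -/
def IsSpanner (t : ℝ) (G H : SimpleGraph P) : Prop :=
  1 ≤ t ∧ H ≤ G ∧ ∀ u v : P, graphDist H u v ≤ ENNReal.ofReal t * graphDist G u v

end ConstrainedTheta

end

namespace ConstrainedTheta

/-! It suffices to approximate each visibility edge `uw`, by induction on its length. Since `m` is
odd, the bisector directions and their opposites are spaced by `θ/2`, so after possibly swapping
ends `uw` makes an angle of at most `θ/4` with the bisector of a cone of `u`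
(`exists_cone_near_bisector`). Let `v` be the closest visible vertex in a subcone containing `w`,
and `q` the point of `uw` with the same projection on the bisector as `v`.

Two facts suffice. By trigonometry, |uv| + t|vq| ≤ t|uq| (`norm_add_mul_norm_le`); `t` gives
equality in the worst position. By planarity, a chain of visibility edges of total length at most
|vq| + |qw| < |uw| joins `v` to `w` (`chain_connected`). Induction on its links gives |uv| + t(|vq|
+ |qw|) ≤ t|uw|.

The chain arises by turning a ray about `v` from `vu` towards `vw` until it meets a vertex `p` of
the triangle `uvw`. The swept region is empty, so a constraint hiding `p` from `u` or `v` would have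
to cross `uv` or `uw` or start at `u` into the angle (`visible_of_empty`); all are excluded. The
construction continues with `p` in place of `v`. -/

/-! ### Signed areas and proper intersection. -/

theorem side_combo (p q x y : Plane) {c d : ℝ} (h : c + d = 1) :
    side p q (c • x + d • y) = c * side p q x + d * side p q y := by
  obtain rfl : d = 1 - c := by linarith
  simp only [side, PiLp.add_apply, PiLp.smul_apply, smul_eq_mul]
  ring

theorem side_swap (p q x : Plane) : side p x q = -side p q x := by
  simp only [side]; ring

@[simp] theorem side_self_left (p q : Plane) : side p q p = 0 := by
  simp only [side]; ring

@[simp] theorem side_self_right (p q : Plane) : side p q q = 0 := by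
  simp only [side]; ring

theorem collinear_of_side_eq_zero {p q x : Plane} (hpq : p ≠ q) (h : side p q x = 0) :
    Collinear ℝ ({p, q, x} : Set Plane) := by
  rw [collinear_iff_of_mem (p₀ := p) (by simp)]
  set N := (q 0 - p 0) ^ 2 + (q 1 - p 1) ^ 2 with hN
  have hN0 : N ≠ 0 := by
    intro h0
    apply hpq
    have h1 : q 0 - p 0 = 0 := by nlinarith [sq_nonneg (q 0 - p 0), sq_nonneg (q 1 - p 1)]
    have h2 : q 1 - p 1 = 0 := by nlinarith [sq_nonneg (q 0 - p 0), sq_nonneg (q 1 - p 1)]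
    ext j
    fin_cases j
    · simp only [Fin.zero_eta]; linarith
    · simp only [Fin.mk_one]; linarith
  refine ⟨q - p, ?_⟩
  simp only [Set.mem_insert_iff, Set.mem_singleton_iff, forall_eq_or_imp, forall_eq]
  refine ⟨⟨0, by simp⟩, ⟨1, by simp⟩,
    ⟨((q 0 - p 0) * (x 0 - p 0) + (q 1 - p 1) * (x 1 - p 1)) / N, ?_⟩⟩
  simp only [side] at h
  ext j
  fin_cases j <;>
    simp only [Fin.zero_eta, Fin.mk_one, vadd_eq_add, PiLp.add_apply, PiLp.smul_apply, PiLp.sub_apply,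
      smul_eq_mul] <;> field_simp <;> rw [hN]
  · linear_combination (-(q 1 - p 1)) * h
  · linear_combination (q 0 - p 0) * h

/-- Two segments that share an interior point intersect properly unless they are parallel. -/
theorem properlyIntersect_of_mem {p q a b e : Plane} (he : e ∈ openSegment ℝ p q)
    (he' : e ∈ openSegment ℝ a b) (ha : side p q a ≠ 0) : ProperlyIntersect p q a b := by
  have key : ∀ z ∈ openSegment ℝ p q, side p q z = 0 := by
    rintro z ⟨c, d, -, -, hcd, rfl⟩
    simp [side_combo p q p q hcd]
  refine ⟨e, Set.eq_singleton_iff_unique_mem.2 ⟨⟨he, he'⟩, ?_⟩⟩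
  rintro z ⟨hz, hz'⟩
  have h1 := key e he
  have h2 := key z hz
  obtain ⟨c, d, -, -, hcd, rfl⟩ := he'
  obtain ⟨c', d', -, -, hcd', rfl⟩ := hz'
  rw [side_combo p q a b hcd] at h1
  rw [side_combo p q a b hcd'] at h2
  obtain rfl : d = 1 - c := by linarith
  obtain rfl : d' = 1 - c' := by linarith
  -- `side p q` is affine and vanishes at both points of `ab`; were it constant along `ab`, it would
  -- vanish at `a`.
  have h3 : (c - c') * (side p q a - side p q b) = 0 := by linear_combination h1 - h2
  rcases mul_eq_zero.1 h3 with h | h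
  · obtain rfl : c = c' := by linarith
    rfl
  · exact absurd (by linear_combination h1 + (1 - c) * h) ha

/-! ### Oblique coordinates at the apex `u`. -/

/-- The coefficient of `v - u` when `x - u` is written in terms of `v - u` and `w - u`. -/
noncomputable def bary (u v w x : Plane) : ℝ := side u x w / side u v w

theorem bary_eq_neg_div (u v w x : Plane) : bary u v w x = -side u w x / side u v w := by
  rw [bary, side_swap]

theorem bary_combo (u v w x y : Plane) {c d : ℝ} (h : c + d = 1) :
    bary u v w (c • x + d • y) = c * bary u v w x + d * bary u v w y := by
  simp only [bary_eq_neg_div, side_combo u w x y h]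
  ring

theorem eq_add_bary {u v w : Plane} (h : side u v w ≠ 0) (x : Plane) :
    x = u + (bary u v w x • (v - u) + bary u w v x • (w - u)) := by
  have h' : side u w v = -side u v w := side_swap _ _ _
  rw [bary, bary, h']
  ext j
  fin_cases j <;>
    simp only [Fin.zero_eta, Fin.mk_one, PiLp.add_apply, PiLp.smul_apply, PiLp.sub_apply,
      smul_eq_mul] <;> field_simp <;> simp only [side] <;> ring

theorem side_swap_ne {u v w : Plane} (h : side u v w ≠ 0) : side u w v ≠ 0 := by
  rw [side_swap]; exact neg_ne_zero.2 h

theorem bary_left {u v w : Plane} (h : side u v w ≠ 0) : bary u v w v = 1 := div_self h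

@[simp] theorem bary_apex (u v w : Plane) : bary u v w u = 0 := by simp [bary_eq_neg_div]

@[simp] theorem bary_right (u v w : Plane) : bary u v w w = 0 := by simp [bary]

/-! ### Visibility in a triangle. -/

variable {P : Finset Plane}

/-- No three points of `P` are collinear. -/
def NoThreeCollinear (P : Finset Plane) : Prop :=
  ∀ u v w : P, u ≠ v → u ≠ w → v ≠ w → side u v w ≠ 0

theorem GeneralPosition.noThreeCollinear {m : ℕ} (h : GeneralPosition m P) :
    NoThreeCollinear P := by
  intro u v w huv huw hvw hs
  have huv' : (u : Plane) ≠ v := fun e => huv (Subtype.ext e)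
  exact h.not_collinear u u.2 v v.2 w w.2 huv' (fun e => huw (Subtype.ext e))
    (fun e => hvw (Subtype.ext e)) (collinear_of_side_eq_zero huv' hs)

/-- No constraint properly crosses another, so for planar `S` the first alternative in the
definition implies the second. -/
theorem visGraph_adj_iff {S : SimpleGraph P} (hS : PlanarConstraints S) {u v : P} :
    (visGraph S).Adj u v ↔ u ≠ v ∧ ∀ a b : P, S.Adj a b → ¬ ProperlyIntersect u v a b := by
  refine ⟨fun h => ⟨h.1, ?_⟩, fun h => ⟨h.1, Or.inr h.2⟩⟩
  rcases h.2 with h' | h'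
  · exact fun a b hab => hS u v a b h' hab
  · exact h'

/-- A constraint cannot enter the part of the triangle `u v w` below a line through `v`, when this
part contains no points of `P`, no constraint at `u` enters the angle at `u`, and `u` sees `v`
and `w`. -/
theorem no_constraint_enters {S : SimpleGraph P} (hN : NoThreeCollinear P)
    {u v w : P} (hD : side u v w ≠ 0)
    (huv : ∀ a b : P, S.Adj a b → ¬ ProperlyIntersect u v a b)
    (huw : ∀ a b : P, S.Adj a b → ¬ ProperlyIntersect u w a b)
    (hwedge : ∀ z : P, S.Adj u z → ¬ (0 < bary u v w z ∧ 0 < bary u w v z))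
    {s : ℝ} (hs : 0 < s) (hs1 : s ≤ 1)
    (hE : ∀ p : P, 0 ≤ bary u v w p → 0 ≤ bary u w v p →
      s * bary u v w p + bary u w v p < s → p = u)
    {a b : P} (hab : S.Adj a b) {y : Plane} (hy : y ∈ openSegment ℝ (a : Plane) b)
    (hα : 0 < bary u v w y) (hβ : 0 < bary u w v y)
    (hf : s * bary u v w y + bary u w v y ≤ s)
    (hfa : s * bary u v w a + bary u w v a < s) : False := by
  by_cases hau : a = u
  · subst hau
    obtain ⟨c, d, hc, hd, hcd, rfl⟩ := hy
    rw [bary_combo _ _ _ _ _ hcd, bary_apex] at hα hβ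
    refine hwedge b hab ⟨?_, ?_⟩
    · nlinarith
    · nlinarith
  -- The closed angle below the line contains no vertex but `u`, so `a` lies outside the angle.
  have hneg : min (bary u v w a) (bary u w v a) < 0 := by
    by_contra! hcon
    rw [le_min_iff] at hcon
    exact hau (hE a hcon.1 hcon.2 hfa)
  -- The smaller oblique coordinate on the way from `y` to `a`; at its zero the constraint leaves
  -- the angle, strictly below the line because `a` is.
  set g : ℝ → ℝ := fun τ => min ((1 - τ) * bary u v w y + τ * bary u v w a)
    ((1 - τ) * bary u w v y + τ * bary u w v a) with hg
  have hgc : Continuous g := by fun_prop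
  obtain ⟨τ, ⟨hτ0, hτ1⟩, hτ⟩ : (0 : ℝ) ∈ g '' Set.Ioo 0 1 := by
    apply intermediate_value_Ioo' zero_le_one hgc.continuousOn
    constructor
    · simpa [hg] using hneg
    · simp [hg, hα, hβ]
  set e : Plane := (1 - τ) • y + τ • (a : Plane) with he
  have hsum : (1 - τ) + τ = 1 := by ring
  have hαe : bary u v w e = (1 - τ) * bary u v w y + τ * bary u v w a := bary_combo _ _ _ _ _ hsum
  have hβe : bary u w v e = (1 - τ) * bary u w v y + τ * bary u w v a := bary_combo _ _ _ _ _ hsum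
  have hmin : min (bary u v w e) (bary u w v e) = 0 := by rw [hαe, hβe]; exact hτ
  have hfe : s * bary u v w e + bary u w v e < s := by
    rw [hαe, hβe]
    nlinarith
  have heab : e ∈ openSegment ℝ (a : Plane) b := by
    obtain ⟨c, d, hc, hd, hcd, rfl⟩ := hy
    refine ⟨(1 - τ) * c + τ, (1 - τ) * d, by nlinarith, by nlinarith,
      by linear_combination (1 - τ) * hcd, ?_⟩
    rw [he]
    module
  have hrepr := eq_add_bary hD e
  -- The three cases place `e` on `uw`, at `u`, or on `uv`.
  rcases lt_trichotomy (bary u v w e) (bary u w v e) with hlt | heq | hlt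
  · rw [min_eq_left hlt.le] at hmin
    rw [hmin] at hrepr hlt hfe
    refine huw a b hab (properlyIntersect_of_mem ?_ heab ?_)
    · refine ⟨1 - bary u w v e, bary u w v e, by nlinarith, hlt, by ring, ?_⟩
      nth_rw 3 [hrepr]
      module
    · intro h0
      have : bary u v w a = 0 := by rw [bary_eq_neg_div, h0]; simp
      rw [this] at hαe
      nlinarith
  · rw [← heq, min_self] at hmin
    rw [← heq, hmin] at hrepr
    have heu : e = u := by rw [hrepr]; simp
    rw [heu] at heab
    have hne : (a : Plane) ≠ b := fun h => hab.ne (Subtype.ext h)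
    have hub : b ≠ u := by
      rintro rfl
      exact hne (right_mem_openSegment_iff.1 heab)
    refine hN a b u hab.ne hau hub ?_
    obtain ⟨c, d, -, -, hcd, h⟩ := heab
    rw [← h, side_combo _ _ _ _ hcd]
    simp
  · rw [min_eq_right hlt.le] at hmin
    rw [hmin] at hrepr hlt hfe
    refine huv a b hab (properlyIntersect_of_mem ?_ heab ?_)
    · refine ⟨1 - bary u v w e, bary u v w e, by nlinarith, hlt, by ring, ?_⟩
      nth_rw 3 [hrepr]
      module
    · intro h0
      have : bary u w v a = 0 := by rw [bary_eq_neg_div, h0]; simp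
      rw [this] at hβe
      nlinarith

theorem not_properlyIntersect_self {a b : Plane} (h : a ≠ b) : ¬ ProperlyIntersect a b a b := by
  rintro ⟨e, he⟩
  rw [Set.inter_self] at he
  have h1 : (1 / 2 : ℝ) • a + (1 / 2 : ℝ) • b ∈ openSegment ℝ a b :=
    ⟨_, _, by norm_num, by norm_num, by norm_num, rfl⟩
  have h2 : (1 / 3 : ℝ) • a + (2 / 3 : ℝ) • b ∈ openSegment ℝ a b :=
    ⟨_, _, by norm_num, by norm_num, by norm_num, rfl⟩
  rw [he, Set.mem_singleton_iff] at h1 h2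
  have h3 : (1 / 6 : ℝ) • (a - b) = 0 := by
    have : (1 / 2 : ℝ) • a + (1 / 2 : ℝ) • b - ((1 / 3 : ℝ) • a + (2 / 3 : ℝ) • b) = 0 := by
      rw [h1, h2, sub_self]
    rw [← this]
    module
  rw [smul_eq_zero, sub_eq_zero] at h3
  exact h3.elim (by norm_num) h

/-- The bracket is the determinant of `p - v` and `x - v` in oblique coordinates. -/
theorem side_eq_bary {u v w : Plane} (h : side u v w ≠ 0) (p x : Plane) :
    side v p x = side u v w *
      ((bary u v w p - 1) * bary u w v x - bary u w v p * (bary u v w x - 1)) := by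
  have h' : side u w v = -side u v w := side_swap _ _ _
  simp only [bary, h']
  field_simp
  simp only [side]
  ring

/-- With `bary_mul_add`, the change of coordinates when `v` is replaced by `p`. -/
theorem bary_mul {u v w p : Plane} (h : side u p w ≠ 0) (z : Plane) :
    bary u v w z = bary u p w z * bary u v w p := by
  simp only [bary]
  field_simp

theorem bary_mul_add {u v w p : Plane} (hD : side u v w ≠ 0) (h : side u p w ≠ 0) (z : Plane) :
    bary u w v z = bary u p w z * bary u w v p + bary u w p z := by
  have h' : side u w v = -side u v w := side_swap _ _ _
  have h'' : side u w p = -side u p w := side_swap _ _ _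
  simp only [bary, h', h'']
  field_simp
  simp only [side]
  ring

theorem lt_or_lt_of_combo {c d x y s : ℝ} (hc : 0 < c) (hd : 0 < d) (hcd : c + d = 1)
    (h : c * x + d * y ≤ s) : x < s ∨ y < s ∨ (x = s ∧ y = s) := by
  obtain rfl : d = 1 - c := by linarith
  rcases lt_or_ge x s with hx | hx
  · exact Or.inl hx
  rcases lt_or_ge y s with hy | hy
  · exact Or.inr (Or.inl hy)
  exact Or.inr (Or.inr ⟨by nlinarith, by nlinarith⟩)

/-- If no point of `P` lies in the triangle `u v w` strictly below the line through `v` and `p`,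
then `p` is visible from `u` and from `v`. -/
theorem visible_of_empty {S : SimpleGraph P} (hS : PlanarConstraints S) (hN : NoThreeCollinear P)
    {u v w p : P} (hD : side u v w ≠ 0)
    (huv : (visGraph S).Adj u v) (huw : (visGraph S).Adj u w)
    (hwedge : ∀ z : P, S.Adj u z → ¬ (0 < bary u v w z ∧ 0 < bary u w v z))
    {s : ℝ} (hs : 0 < s) (hs1 : s ≤ 1)
    (hE : ∀ p : P, 0 ≤ bary u v w p → 0 ≤ bary u w v p →
      s * bary u v w p + bary u w v p < s → p = u)
    (hpu : p ≠ u) (hpv : p ≠ v)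
    (hα : 0 ≤ bary u v w p) (hβ : 0 < bary u w v p)
    (hp : s * bary u v w p + bary u w v p = s) :
    (visGraph S).Adj u p ∧ (visGraph S).Adj v p := by
  have huv' := ((visGraph_adj_iff hS).1 huv).2
  have huw' := ((visGraph_adj_iff hS).1 huw).2
  -- The line `vp` has the equation s·α + β = s in oblique coordinates α, β. A constraint that
  -- reaches the open angle on or below it has no endpoint strictly below, hence runs along it.
  have enter : ∀ a b : P, S.Adj a b → ∀ y ∈ openSegment ℝ (a : Plane) b, 0 < bary u v w y →
      0 < bary u w v y → s * bary u v w y + bary u w v y ≤ s →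
      s * bary u v w y + bary u w v y = s ∧ s * bary u v w a + bary u w v a = s ∧
      s * bary u v w b + bary u w v b = s := by
    intro a b hab y hy hαy hβy hfy
    have hy' := hy
    obtain ⟨c, d, hc, hd, hcd, rfl⟩ := hy'
    have hcomb : s * bary u v w (c • (a : Plane) + d • (b : Plane)) +
        bary u w v (c • (a : Plane) + d • (b : Plane)) =
        c * (s * bary u v w a + bary u w v a) + d * (s * bary u v w b + bary u w v b) := by
      rw [bary_combo _ _ _ _ _ hcd, bary_combo _ _ _ _ _ hcd]
      ring
    rcases lt_or_lt_of_combo hc hd hcd (hcomb ▸ hfy) with h | h | ⟨h, h'⟩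
    · exact (no_constraint_enters hN hD huv' huw' hwedge hs hs1 hE hab hy hαy hβy hfy h).elim
    · rw [openSegment_symm] at hy
      exact (no_constraint_enters hN hD huv' huw' hwedge hs hs1 hE hab.symm hy hαy hβy hfy h).elim
    · exact ⟨by rw [hcomb, h, h', ← add_mul, hcd, one_mul], h, h'⟩
  constructor
  · by_cases hpw : p = w
    · rwa [hpw]
    rw [visGraph_adj_iff hS]
    refine ⟨hpu.symm, ?_⟩
    rintro a b hab ⟨y, hy⟩
    obtain ⟨hy1, hy2⟩ : y ∈ openSegment ℝ (u : Plane) p ∧ y ∈ openSegment ℝ (a : Plane) b := by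
      rw [← Set.mem_inter_iff, hy]; rfl
    have hα' : 0 < bary u v w p := by
      refine lt_of_le_of_ne hα (Ne.symm ?_)
      rw [bary]
      exact div_ne_zero (hN u p w hpu.symm huw.ne hpw) hD
    obtain ⟨c, d, hc, hd, hcd, rfl⟩ := hy1
    have h1 : bary u v w (c • (u : Plane) + d • (p : Plane)) = d * bary u v w p := by
      rw [bary_combo _ _ _ _ _ hcd]; simp
    have h2 : bary u w v (c • (u : Plane) + d • (p : Plane)) = d * bary u w v p := by
      rw [bary_combo _ _ _ _ _ hcd]; simp
    have h3 : s * bary u v w (c • (u : Plane) + d • (p : Plane)) +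
        bary u w v (c • (u : Plane) + d • (p : Plane)) < s := by
      rw [h1, h2]; nlinarith
    exact h3.ne (enter a b hab _ hy2 (by rw [h1]; positivity) (by rw [h2]; positivity) h3.le).1
  · rw [visGraph_adj_iff hS]
    refine ⟨hpv.symm, ?_⟩
    rintro a b hab hI
    have hI' := hI
    obtain ⟨y, hy⟩ := hI'
    obtain ⟨hy1, hy2⟩ : y ∈ openSegment ℝ (v : Plane) p ∧ y ∈ openSegment ℝ (a : Plane) b := by
      rw [← Set.mem_inter_iff, hy]; rfl
    obtain ⟨c, d, hc, hd, hcd, rfl⟩ := hy1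
    have h1 : bary u v w (c • (v : Plane) + d • (p : Plane)) = c + d * bary u v w p := by
      rw [bary_combo _ _ _ _ _ hcd, bary_left hD, mul_one]
    have h2 : bary u w v (c • (v : Plane) + d • (p : Plane)) = d * bary u w v p := by
      rw [bary_combo _ _ _ _ _ hcd]; simp
    have h3 : s * bary u v w (c • (v : Plane) + d • (p : Plane)) +
        bary u w v (c • (v : Plane) + d • (p : Plane)) = s := by
      rw [h1, h2]; linear_combination d * hp + s * hcd
    obtain ⟨-, ha, hb⟩ := enter a b hab _ hy2 (by rw [h1]; positivity) (by rw [h2]; positivity) h3.le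
    -- Without collinear triples, a constraint along the line `vp` is `vp` itself, and a segment
    -- does not properly intersect itself.
    have online : ∀ x : P, s * bary u v w x + bary u w v x = s → x = v ∨ x = p := by
      intro x hx
      by_contra! hcon
      refine hN v p x hpv.symm hcon.1.symm hcon.2.symm ?_
      rw [side_eq_bary hD]
      apply mul_eq_zero_of_right
      linear_combination (bary u v w p - 1) * hx - (bary u v w x - 1) * hp
    rcases online a ha with rfl | rfl <;> rcases online b hb with rfl | rfl
    · exact hab.ne rfl
    · exact not_properlyIntersect_self (fun h => hpv (Subtype.ext h.symm)) hI
    · refine not_properlyIntersect_self (fun h => hpv (Subtype.ext h.symm)) ?_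
      unfold ProperlyIntersect at hI ⊢
      rwa [openSegment_symm ℝ (a : Plane) b] at hI
    · exact hab.ne rfl

/-! ### The chain of visibility edges. -/

theorem dist_lineMap_add {a b : Plane} {r s : ℝ} (h : r ≤ s) :
    dist (a + r • (b - a)) (a + s • (b - a)) = (s - r) * dist a b := by
  rw [dist_add_left, dist_eq_norm, ← sub_smul, norm_smul, Real.norm_eq_abs, abs_of_nonpos (by linarith),
    dist_comm, dist_eq_norm]
  ring

/-- If `u` sees `v` and `w`, then `v` and `w` are connected by a chain of visibility edges in the
triangle `u v w` that is not longer than the path from `v` via `q` to `w`, provided that `q` is a point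
of the segment `u w` such that no point of the triangle `u v q` below the line `v q` is visible
from `u`. -/
theorem chain_connected {S : SimpleGraph P} (hS : PlanarConstraints S) (hN : NoThreeCollinear P)
    {t R : ℝ} (ht : 0 ≤ t) {C : P → P → ℝ → Prop}
    (htrans : ∀ a b c L L', C a b L → C b c L' → C a c (L + L'))
    (hmono : ∀ a b L L', C a b L → L ≤ L' → C a b L')
    (hedge : ∀ a b : P, (visGraph S).Adj a b → dist (a : Plane) b < R →
      C a b (t * dist (a : Plane) b)) {u w : P} (huw : (visGraph S).Adj u w) (n : ℕ) :
    ∀ v : P, side u v w ≠ 0 → (visGraph S).Adj u v →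
    (∀ z : P, S.Adj u z → ¬ (0 < bary u v w z ∧ 0 < bary u w v z)) →
    ∀ s : ℝ, 0 < s → s ≤ 1 →
    (∀ p : P, (visGraph S).Adj u p → 0 ≤ bary u v w p → 0 ≤ bary u w v p →
      bary u v w p + bary u w v p ≤ 1 → s ≤ s * bary u v w p + bary u w v p) →
    {p : P | 0 ≤ bary u v w p ∧ 0 ≤ bary u w v p ∧ bary u v w p + bary u w v p ≤ 1}.ncard < n →
    dist (v : Plane) (u + s • (w - u : Plane)) + dist (u + s • (w - u : Plane)) w < R →
    C v w (t * (dist (v : Plane) (u + s • (w - u : Plane)) + dist (u + s • (w - u : Plane)) w)) := by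
  classical
  -- `n` strictly bounds the number of vertices in the triangle `uvw`.
  induction n with
  | zero => intro v _ _ _ s _ _ _ h; exact absurd h (Nat.not_lt_zero _)
  | succ n ih =>
  intro v hD huv hwedge s hs hs1 hvis hcard hR
  set A : Finset P := Finset.univ.filter fun p => 0 ≤ bary u v w p ∧ 0 ≤ bary u w v p ∧
    bary u v w p + bary u w v p ≤ 1 ∧ p ≠ u ∧ p ≠ v with hA
  have memA : ∀ p, p ∈ A ↔ 0 ≤ bary u v w p ∧ 0 ≤ bary u w v p ∧
    bary u v w p + bary u w v p ≤ 1 ∧ p ≠ u ∧ p ≠ v := by simp [hA]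
  have hvw : w ≠ v := by rintro rfl; simp at hD
  have hwA : w ∈ A := by
    rw [memA, bary_right, bary_left (side_swap_ne hD)]
    exact ⟨le_rfl, zero_le_one, by norm_num, huw.ne.symm, hvw⟩
  have hAβ : ∀ p ∈ A, 0 < bary u w v p := by
    intro p hp
    obtain ⟨-, h2, -, h4, h5⟩ := (memA p).1 hp
    refine lt_of_le_of_ne h2 (Ne.symm ?_)
    rw [bary]
    exact div_ne_zero (hN u p v h4.symm huv.ne h5) (side_swap_ne hD)
  have hAα : ∀ p ∈ A, bary u v w p < 1 := by
    intro p hp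
    have := hAβ p hp
    have := ((memA p).1 hp).2.2.1
    linarith
  -- The line through `v` and `p` meets `uw` at parameter β/(1 - α); the minimum selects the first
  -- vertex met by a ray turning about `v` away from `vu`.
  obtain ⟨p, hpA, hmin⟩ := A.exists_min_image (fun p => bary u w v p / (1 - bary u v w p)) ⟨w, hwA⟩
  obtain ⟨hα, -, hαβ, hpu, hpv⟩ := (memA p).1 hpA
  have hβ := hAβ p hpA
  have hα1 := hAα p hpA
  set r : ℝ := bary u w v p / (1 - bary u v w p) with hr
  have hpos : 0 < 1 - bary u v w p := by linarith
  have hr0 : 0 < r := by positivity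
  have hβr : bary u w v p = r * (1 - bary u v w p) := by rw [hr]; field_simp
  have hr1 : r ≤ 1 := by rw [hr, div_le_one hpos]; linarith
  have hmin' : ∀ z ∈ A, r * (1 - bary u v w z) ≤ bary u w v z := by
    intro z hz
    have h1 : 0 < 1 - bary u v w z := by linarith [hAα z hz]
    exact (le_div_iff₀ h1).1 (hmin z hz)
  have hE : ∀ z : P, 0 ≤ bary u v w z → 0 ≤ bary u w v z →
      r * bary u v w z + bary u w v z < r → z = u := by
    intro z h1 h2 h3
    by_contra hzu
    have hzv : z ≠ v := by
      rintro rfl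
      rw [bary_left hD, bary_right] at h3
      linarith
    have h4 : bary u v w z < 1 := by nlinarith
    have hzA : z ∈ A := (memA z).2 ⟨h1, h2, by nlinarith, hzu, hzv⟩
    have := hmin' z hzA
    linarith
  obtain ⟨hup, hvp⟩ := visible_of_empty hS hN hD huv huw hwedge hr0 hr1 hE hpu hpv hα hβ
    (by rw [hβr]; ring)
  -- As `u` sees `p`, the vertex `p` is not below `vq`. Hence `q'` lies between `q` and `w`, and the
  -- detour via `q'` is no longer.
  have hsr : s ≤ r := by
    have := hvis p hup hα hβ.le hαβ
    rw [hβr] at this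
    nlinarith
  set q : Plane := u + s • (w - u : Plane) with hq
  set q' : Plane := u + r • (w - u : Plane) with hq'
  have hw1 : (w : Plane) = u + (1 : ℝ) • (w - u : Plane) := by simp
  have hqq' : dist q q' + dist q' w = dist q w := by
    have h1 := dist_lineMap_add (a := (u : Plane)) (b := w) hsr
    have h2 := dist_lineMap_add (a := (u : Plane)) (b := w) hr1
    have h3 := dist_lineMap_add (a := (u : Plane)) (b := w) hs1
    rw [← hw1] at h2 h3
    rw [h1, h2, h3]
    ring
  have hle : dist (v : Plane) q' + dist q' w ≤ dist (v : Plane) q + dist q w := by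
    have := dist_triangle (v : Plane) q q'
    linarith
  by_cases hpw : p = w
  · rw [hpw] at hvp
    have h1 := dist_triangle (v : Plane) q w
    exact hmono _ _ _ _ (hedge v w hvp (by linarith)) (by gcongr)
  have hD' : side u p w ≠ 0 := hN u p w hpu.symm huw.ne hpw
  have hp_eq : (p : Plane) = v + (1 - bary u v w p) • (q' - v) := by
    nth_rw 1 [eq_add_bary hD p, hβr, hq']
    module
  have hvp_dist : dist (v : Plane) p = (1 - bary u v w p) * dist (v : Plane) q' := by
    have := dist_lineMap_add (a := (v : Plane)) (b := q') hpos.le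
    rwa [← hp_eq, zero_smul, add_zero, sub_zero] at this
  have hpq_dist : dist (p : Plane) q' = bary u v w p * dist (v : Plane) q' := by
    have := dist_lineMap_add (a := (v : Plane)) (b := q') (r := 1 - bary u v w p) (s := 1) (by linarith)
    rw [← hp_eq, one_smul, add_sub_cancel] at this
    rw [this]; ring
  have htri : ∀ z : P, 0 ≤ bary u p w z → 0 ≤ bary u w p z → bary u p w z + bary u w p z ≤ 1 →
      0 ≤ bary u v w z ∧ 0 ≤ bary u w v z ∧ bary u v w z + bary u w v z ≤ 1 ∧ z ≠ v := by
    intro z h1 h2 h3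
    have e1 := bary_mul (v := (v : Plane)) hD' z
    have e2 := bary_mul_add hD hD' z
    refine ⟨by rw [e1]; positivity, by rw [e2]; positivity, by rw [e1, e2]; nlinarith, ?_⟩
    rintro rfl
    rw [bary_left hD] at e1
    nlinarith
  have hrest : dist (v : Plane) p + dist (p : Plane) q' = dist (v : Plane) q' := by
    rw [hvp_dist, hpq_dist]; ring
  have hpn := dist_nonneg (x := (v : Plane)) (y := p)
  -- The lines `pq'` and `vq'` coincide, so minimality of `r` yields the hypothesis for the triangle
  -- `upw`, which no longer contains `v`.
  have key := ih p hD' hup ?_ r hr0 hr1 ?_ ?_ (by rw [← hq']; linarith)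
  · have hvp_lt : dist (v : Plane) p < R := by
      have h1 := dist_nonneg (x := (p : Plane)) (y := q')
      have h2 := dist_nonneg (x := q') (y := (w : Plane))
      linarith
    refine hmono _ _ _ _ (htrans _ _ _ _ _ (hedge v p hvp hvp_lt) key) ?_
    rw [← hq', ← mul_add]
    exact mul_le_mul_of_nonneg_left (by linarith) ht
  · rintro z hz ⟨h1, h2⟩
    have e1 := bary_mul (v := (v : Plane)) hD' z
    have e2 := bary_mul_add hD hD' z
    have hα' : 0 < bary u v w p := lt_of_le_of_ne hα (Ne.symm (div_ne_zero hD' hD))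
    exact hwedge z hz ⟨by rw [e1]; positivity, by rw [e2]; positivity⟩
  · intro z hz h1 h2 h3
    obtain ⟨g1, g2, g3, g4⟩ := htri z h1 h2 h3
    have := hmin' z ((memA z).2 ⟨g1, g2, g3, hz.ne.symm, g4⟩)
    rw [bary_mul (v := (v : Plane)) hD' z, bary_mul_add hD hD' z, hβr] at this
    linarith
  · refine lt_of_lt_of_le (Set.ncard_lt_ncard (t := {p : P | 0 ≤ bary u v w p ∧ 0 ≤ bary u w v p ∧
      bary u v w p + bary u w v p ≤ 1}) ?_ (Set.toFinite _)) (Nat.lt_succ_iff.1 hcard)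
    rw [Set.ssubset_iff_of_subset]
    · refine ⟨v, ?_, ?_⟩
      · simp [bary_left hD]
      · rintro ⟨h1, h2, h3⟩
        exact (htri v h1 h2 h3).2.2.2 rfl
    · rintro z ⟨h1, h2, h3⟩
      obtain ⟨g1, g2, g3, -⟩ := htri z h1 h2 h3
      exact ⟨g1, g2, g3⟩

/-! ### Coordinates adapted to a cone. -/

/-- The coordinate of `y` along `dir φ`. -/
noncomputable def along (φ : ℝ) (y : Plane) : ℝ := y 0 * Real.sin φ + y 1 * Real.cos φ

/-- The coordinate of `y` perpendicular to `dir φ`. -/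
noncomputable def across (φ : ℝ) (y : Plane) : ℝ := y 0 * Real.cos φ - y 1 * Real.sin φ

theorem inner_dir (φ : ℝ) (y : Plane) : inner ℝ (dir φ) y = along φ y := by
  simp [PiLp.inner_apply, Fin.sum_univ_two, dir, along]

theorem along_combo (φ c d : ℝ) (x y : Plane) :
    along φ (c • x + d • y) = c * along φ x + d * along φ y := by
  simp only [along, PiLp.add_apply, PiLp.smul_apply, smul_eq_mul]; ring

theorem across_combo (φ c d : ℝ) (x y : Plane) :
    across φ (c • x + d • y) = c * across φ x + d * across φ y := by
  simp only [across, PiLp.add_apply, PiLp.smul_apply, smul_eq_mul]; ring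

theorem along_smul (φ c : ℝ) (x : Plane) : along φ (c • x) = c * along φ x := by
  simp only [along, PiLp.smul_apply, smul_eq_mul]; ring

theorem across_smul (φ c : ℝ) (x : Plane) : across φ (c • x) = c * across φ x := by
  simp only [across, PiLp.smul_apply, smul_eq_mul]; ring

theorem along_dir (φ ψ : ℝ) : along φ (dir ψ) = Real.cos (ψ - φ) := by
  simp [along, dir, Real.cos_sub]; ring

theorem across_dir (φ ψ : ℝ) : across φ (dir ψ) = Real.sin (ψ - φ) := by
  simp [across, dir, Real.sin_sub]

theorem norm_eq_sqrt_along_across (φ : ℝ) (y : Plane) :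
    ‖y‖ = Real.sqrt (along φ y ^ 2 + across φ y ^ 2) := by
  rw [EuclideanSpace.norm_eq, Fin.sum_univ_two]
  congr 1
  simp only [along, across, Real.norm_eq_abs, sq_abs]
  linear_combination (-(y 0 ^ 2 + y 1 ^ 2)) * Real.sin_sq_add_cos_sq φ

theorem eq_of_along_across {φ : ℝ} {x y : Plane} (h : along φ x = along φ y)
    (h' : across φ x = across φ y) : x = y := by
  rw [← sub_eq_zero, ← norm_eq_zero, norm_eq_sqrt_along_across φ]
  have e := along_combo φ 1 (-1) x y
  have e' := across_combo φ 1 (-1) x y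
  have hxy : (1 : ℝ) • x + (-1 : ℝ) • y = x - y := by module
  rw [hxy] at e e'
  rw [e, e', h, h']
  simp

theorem norm_dir (φ : ℝ) : ‖dir φ‖ = 1 := by
  rw [norm_eq_sqrt_along_across φ, along_dir, across_dir]; simp

theorem exists_eq_smul_dir (y : Plane) : ∃ φ : ℝ, y = ‖y‖ • dir φ := by
  set z : ℂ := ⟨y 1, y 0⟩ with hz
  have hn : ‖z‖ = ‖y‖ := by
    rw [Complex.norm_def, Complex.normSq_apply, EuclideanSpace.norm_eq, Fin.sum_univ_two]
    congr 1
    simp only [hz, Real.norm_eq_abs, sq_abs]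
    ring
  refine ⟨z.arg, ?_⟩
  ext j
  fin_cases j
  · have h := Complex.norm_mul_sin_arg z
    rw [hn] at h
    exact h.symm
  · have h := Complex.norm_mul_cos_arg z
    rw [hn] at h
    exact h.symm

theorem rayDir_eq (m i : ℕ) : rayDir m i = dir (i * aperture m - aperture m / 2) := by
  rw [rayDir]; congr 1; ring

theorem rayDir_succ_eq (m i : ℕ) : rayDir m (i + 1) = dir (i * aperture m + aperture m / 2) := by
  rw [rayDir]; congr 1; push_cast; ring

/-- The division-free form of |across| ≤ along · tan(θ/2). -/
theorem mem_cone_iff {m : ℕ} (hs : 0 < Real.sin (aperture m / 2))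
    (hc : 0 < Real.cos (aperture m / 2)) (u : Plane) (i : ℕ) (x : Plane) :
    x ∈ cone m u i ↔ |across (i * aperture m) (x - u)| * Real.cos (aperture m / 2) ≤
      along (i * aperture m) (x - u) * Real.sin (aperture m / 2) := by
  set φ : ℝ := i * aperture m with hφ
  set σ := Real.sin (aperture m / 2) with hσ
  set κ := Real.cos (aperture m / 2) with hκ
  have h1 : ∀ s t : ℝ, along φ (s • rayDir m i + t • rayDir m (i + 1)) = (s + t) * κ := by
    intro s t
    rw [along_combo, rayDir_eq, rayDir_succ_eq, along_dir, along_dir, ← hφ]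
    rw [show φ - aperture m / 2 - φ = -(aperture m / 2) by ring, Real.cos_neg, add_sub_cancel_left]
    ring
  have h2 : ∀ s t : ℝ, across φ (s • rayDir m i + t • rayDir m (i + 1)) = (t - s) * σ := by
    intro s t
    rw [across_combo, rayDir_eq, rayDir_succ_eq, across_dir, across_dir, ← hφ]
    rw [show φ - aperture m / 2 - φ = -(aperture m / 2) by ring, Real.sin_neg, add_sub_cancel_left]
    ring
  constructor
  · rintro ⟨s, t, hs0, ht0, rfl⟩
    rw [add_sub_cancel_left, h1, h2, abs_mul, abs_of_pos hs, mul_assoc, mul_assoc, mul_comm κ]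
    gcongr
    rw [abs_le]
    constructor <;> linarith
  · intro h
    have hr := le_trans (mul_le_mul_of_nonneg_right (le_abs_self _) hc.le) h
    have hl : -(across φ (x - u) * κ) ≤ along φ (x - u) * σ := by
      have := le_trans (mul_le_mul_of_nonneg_right (neg_le_abs (across φ (x - u))) hc.le) h
      linarith
    refine ⟨(along φ (x - u) * σ - across φ (x - u) * κ) / (2 * (σ * κ)),
      (along φ (x - u) * σ + across φ (x - u) * κ) / (2 * (σ * κ)), ?_, ?_, ?_⟩
    · apply div_nonneg _ (by positivity); linarith
    · apply div_nonneg _ (by positivity); linarith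
    · rw [← sub_eq_iff_eq_add']
      apply eq_of_along_across (φ := φ)
      · rw [h1]; field_simp; ring
      · rw [h2]; field_simp; ring

theorem combo_mem_cone {m i : ℕ} {u v w : Plane} (hv : v ∈ cone m u i) (hw : w ∈ cone m u i)
    {c d : ℝ} (hc : 0 ≤ c) (hd : 0 ≤ d) : u + (c • (v - u) + d • (w - u)) ∈ cone m u i := by
  obtain ⟨s, t, hs, ht, rfl⟩ := hv
  obtain ⟨s', t', hs', ht', rfl⟩ := hw
  refine ⟨c * s + d * s', c * t + d * t', by positivity, by positivity, ?_⟩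
  module

theorem dist_bisectorProj (m i : ℕ) (u x : Plane) :
    dist u (bisectorProj m u i x) = |along (i * aperture m) (x - u)| := by
  rw [bisectorProj, bisectorDir, inner_dir, dist_comm, dist_eq_norm, add_sub_cancel_left, norm_smul,
    norm_dir, mul_one, Real.norm_eq_abs]

/-- Among the opposite directions of a segment, one is within a quarter of the aperture of the bisector
of a cone. -/
theorem exists_cone_near_bisector {m : ℕ} (hm : Odd m) (hm1 : 3 ≤ m) {u w : Plane} (huw : u ≠ w) :
    ∃ i : Fin m,
      (0 < along (i * aperture m) (w - u) ∧ |across (i * aperture m) (w - u)| * Real.cos (aperture m / 4)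
        ≤ along (i * aperture m) (w - u) * Real.sin (aperture m / 4)) ∨
      (0 < along (i * aperture m) (u - w) ∧ |across (i * aperture m) (u - w)| * Real.cos (aperture m / 4)
        ≤ along (i * aperture m) (u - w) * Real.sin (aperture m / 4)) := by
  have hm0 : (0 : ℝ) < m := by exact_mod_cast (by omega : 0 < m)
  have hm3 : (3 : ℝ) ≤ m := by exact_mod_cast hm1
  set θ := aperture m with hθ
  have hmθ : m * θ = 2 * Real.pi := by rw [hθ, aperture]; field_simp
  have hπ := Real.pi_pos
  have hθ0 : 0 < θ := by rw [hθ, aperture]; positivity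
  have hθ1 : θ < Real.pi := by nlinarith
  have good : ∀ (r α : ℝ) (y : Plane) (j : ℤ), 0 < r → |α| ≤ θ / 4 → y = r • dir (j * θ + α) →
      ∃ i : Fin m, 0 < along (i * θ) y ∧
        |across (i * θ) y| * Real.cos (θ / 4) ≤ along (i * θ) y * Real.sin (θ / 4) := by
    intro r α y j hr hα hy
    rw [abs_le] at hα
    have hmz : (0 : ℤ) < m := by exact_mod_cast (by omega : 0 < m)
    have h0 := Int.emod_nonneg j hmz.ne'
    have h1 := Int.emod_lt_of_pos j hmz
    refine ⟨⟨(j % m).toNat, by omega⟩, ?_⟩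
    have hcast : (((j % m).toNat : ℕ) : ℝ) = j - m * (j / m : ℤ) := by
      have e1 : (((j % m).toNat : ℕ) : ℤ) = j - m * (j / m) := by
        rw [Int.toNat_of_nonneg h0, Int.emod_def]
      exact_mod_cast congrArg (Int.cast : ℤ → ℝ) e1
    have e2 : (j : ℝ) * θ + α - (((j % m).toNat : ℕ) : ℝ) * θ = α + (j / m : ℤ) * (2 * Real.pi) := by
      rw [hcast, ← hmθ]; ring
    simp only
    rw [hy, along_smul, across_smul, along_dir, across_dir, e2, Real.cos_add_int_mul_two_pi,
      Real.sin_add_int_mul_two_pi]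
    have hcos : 0 < Real.cos α := Real.cos_pos_of_mem_Ioo ⟨by linarith, by linarith⟩
    refine ⟨by positivity, ?_⟩
    have s1 : 0 ≤ Real.sin (θ / 4 - α) :=
      Real.sin_nonneg_of_nonneg_of_le_pi (by linarith) (by linarith)
    have s2 : 0 ≤ Real.sin (θ / 4 + α) :=
      Real.sin_nonneg_of_nonneg_of_le_pi (by linarith) (by linarith)
    rw [Real.sin_sub] at s1
    rw [Real.sin_add] at s2
    rw [abs_mul, abs_of_pos hr, mul_assoc, mul_assoc]
    refine mul_le_mul_of_nonneg_left ?_ hr.le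
    rcases abs_cases (Real.sin α) with ⟨h, -⟩ | ⟨h, -⟩ <;> rw [h] <;> linarith
  obtain ⟨φ, hφ⟩ := exists_eq_smul_dir (w - u)
  have hr : 0 < ‖w - u‖ := norm_pos_iff.2 (sub_ne_zero.2 huw.symm)
  -- Even multiples of `θ/2` are bisector directions; odd ones are opposite to bisectors, as π =
  -- m·θ/2 with `m` odd.
  set j := round (2 * φ / θ) with hj
  have hα : |φ - j * (θ / 2)| ≤ θ / 4 := by
    have h1 := abs_sub_round (2 * φ / θ)
    have h2 : φ - j * (θ / 2) = (2 * φ / θ - j) * (θ / 2) := by field_simp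
    rw [h2, abs_mul, abs_of_pos (half_pos hθ0)]
    nlinarith
  rcases Int.even_or_odd' j with ⟨l, hl | hl⟩
  · have hl' : (j : ℝ) = 2 * l := by exact_mod_cast hl
    obtain ⟨i, hi⟩ := good ‖w - u‖ (φ - j * (θ / 2)) (w - u) l hr hα (by
      rw [hl', show (l : ℝ) * θ + (φ - 2 * l * (θ / 2)) = φ by ring]; exact hφ)
    exact ⟨i, Or.inl hi⟩
  · have hl' : (j : ℝ) = 2 * l + 1 := by exact_mod_cast hl
    obtain ⟨n, hn⟩ := hm
    have hn' : (m : ℝ) = 2 * n + 1 := by exact_mod_cast hn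
    obtain ⟨i, hi⟩ := good ‖w - u‖ (φ - j * (θ / 2)) (u - w) (l + n + 1) hr hα (by
      have e : ((l + n + 1 : ℤ) : ℝ) * θ + (φ - j * (θ / 2)) = φ + Real.pi := by
        rw [hl']
        push_cast
        rw [hn'] at hmθ
        linear_combination hmθ / 2
      rw [e, ← neg_sub w u]
      nth_rw 1 [hφ]
      rw [← smul_neg]
      congr 1
      ext k
      fin_cases k <;> simp [dir, Real.sin_add_pi, Real.cos_add_pi])
    exact ⟨i, Or.inr hi⟩

/-! ### The trigonometric inequality. -/

/-- `X` is the common projection of `v` and `q`, while `V` and `W` are their offsets from the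
bisector. The worst case has both offsets maximal and on opposite sides; there `hteq` says that
equality holds. -/
theorem sqrt_add_mul_abs_le {c₂ s₂ c₄ s₄ t X V W : ℝ} (hc₂ : 0 < c₂) (hc₄ : 0 < c₄)
    (hs₄ : 0 < s₄) (h₂ : s₂ ^ 2 + c₂ ^ 2 = 1) (h₄ : s₄ ^ 2 + c₄ ^ 2 = 1) (ht : 0 ≤ t)
    (hteq : c₄ + t * (s₂ * c₄ + c₂ * s₄) = t * c₂) (hX : 0 < X)
    (hV : |V| * c₂ ≤ X * s₂) (hW : |W| * c₄ ≤ X * s₄) :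
    Real.sqrt (X ^ 2 + V ^ 2) + t * |V - W| ≤ t * Real.sqrt (X ^ 2 + W ^ 2) := by
  have hV' : |V| ≤ X * s₂ / c₂ := (le_div_iff₀ hc₂).2 hV
  have hW' : |W| ≤ X * s₄ / c₄ := (le_div_iff₀ hc₄).2 hW
  have h1 : Real.sqrt (X ^ 2 + V ^ 2) ≤ X / c₂ := by
    rw [Real.sqrt_le_left (by positivity)]
    have : V ^ 2 ≤ (X * s₂ / c₂) ^ 2 := sq_le_sq' (by linarith [(abs_le.1 hV').1]) (abs_le.1 hV').2
    have e : (X / c₂) ^ 2 = X ^ 2 + (X * s₂ / c₂) ^ 2 := by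
      field_simp; linear_combination -h₂
    linarith
  -- √(X² + σ²) is 1-Lipschitz in σ and equals X/c₄ at the extreme offset.
  have h2 : ∀ σ : ℝ, |σ| ≤ X * s₄ / c₄ → X / c₄ - (X * s₄ / c₄ - σ) ≤ Real.sqrt (X ^ 2 + σ ^ 2) := by
    intro σ hσ
    apply Real.le_sqrt_of_sq_le
    have e : (X / c₄) ^ 2 = X ^ 2 + (X * s₄ / c₄) ^ 2 := by
      field_simp; linear_combination -h₄
    have hs1 : s₄ ≤ 1 := by nlinarith
    have hle : X * s₄ / c₄ ≤ X / c₄ := by gcongr; nlinarith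
    have := (abs_le.1 hσ).2
    nlinarith [mul_nonneg (sub_nonneg.2 hle) (sub_nonneg.2 this)]
  have h3 : X / c₂ + t * (X * s₂ / c₂ + X * s₄ / c₄) = t * (X / c₄) := by
    field_simp; linear_combination hteq
  obtain ⟨σ, hσ, hσ2, hab⟩ : ∃ σ : ℝ, |σ| ≤ X * s₄ / c₄ ∧ σ ^ 2 = W ^ 2 ∧
      |V - W| ≤ X * s₂ / c₂ + σ := by
    rcases abs_cases (V - W) with ⟨h, -⟩ | ⟨h, -⟩
    · exact ⟨-W, by rwa [abs_neg], by ring, by rw [h]; linarith [(abs_le.1 hV').2]⟩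
    · exact ⟨W, hW', by ring, by rw [h]; linarith [(abs_le.1 hV').1]⟩
  have h4 := h2 σ hσ
  rw [hσ2] at h4
  have h5 := mul_le_mul_of_nonneg_left hab ht
  have h6 := mul_le_mul_of_nonneg_left h4 ht
  nlinarith

/-- Used with `x` = v - u and `y` = w - u; the multiple of `y` is then q - u. -/
theorem norm_add_mul_norm_le {θ t φ : ℝ} (h0 : 0 < θ) (h1 : θ < Real.pi) (ht : 0 ≤ t)
    (hteq : Real.cos (θ / 4) + t * Real.sin (3 * θ / 4) = t * Real.cos (θ / 2)) {x y : Plane}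
    (hx : 0 < along φ x) (hy : 0 < along φ y)
    (hx' : |across φ x| * Real.cos (θ / 2) ≤ along φ x * Real.sin (θ / 2))
    (hy' : |across φ y| * Real.cos (θ / 4) ≤ along φ y * Real.sin (θ / 4)) :
    ‖x‖ + t * ‖x - (along φ x / along φ y) • y‖ ≤ t * ‖(along φ x / along φ y) • y‖ := by
  have hsub : ∀ z : Plane, x - z = (1 : ℝ) • x + (-1 : ℝ) • z := fun z => by module
  set s := along φ x / along φ y with hs
  have hs0 : 0 < s := by positivity
  have e1 : along φ (s • y) = along φ x := by rw [along_smul, hs]; field_simp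
  have e2 : along φ (x - s • y) = 0 := by rw [hsub, along_combo, e1]; ring
  have e3 : across φ (x - s • y) = across φ x - across φ (s • y) := by
    rw [hsub, across_combo]; ring
  rw [norm_eq_sqrt_along_across φ x, norm_eq_sqrt_along_across φ (s • y),
    norm_eq_sqrt_along_across φ (x - s • y), e1, e2, e3, zero_pow two_ne_zero, zero_add, Real.sqrt_sq_eq_abs]
  have hsin3 : Real.sin (3 * θ / 4) =
      Real.sin (θ / 2) * Real.cos (θ / 4) + Real.cos (θ / 2) * Real.sin (θ / 4) := by
    rw [← Real.sin_add]; congr 1; ring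
  refine sqrt_add_mul_abs_le (c₂ := Real.cos (θ / 2)) (s₂ := Real.sin (θ / 2))
    (c₄ := Real.cos (θ / 4)) (s₄ := Real.sin (θ / 4))
    (Real.cos_pos_of_mem_Ioo ⟨by linarith, by linarith⟩)
    (Real.cos_pos_of_mem_Ioo ⟨by linarith, by linarith⟩)
    (Real.sin_pos_of_pos_of_lt_pi (by linarith) (by linarith))
    (Real.sin_sq_add_cos_sq _) (Real.sin_sq_add_cos_sq _) ht (by rw [← hsin3]; exact hteq) hx hx' ?_
  have e4 : along φ x = s * along φ y := by rw [← e1, along_smul]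
  rw [across_smul, abs_mul, abs_of_pos hs0, e4, mul_assoc, mul_assoc]
  gcongr

/-- As sin(3θ/4) = cos(π/2 - 3θ/4), the condition is θ/2 < π/2 - 3θ/4, that is, more than five
cones. -/
theorem ratio_pos {θ : ℝ} (h0 : 0 < θ) (h1 : 5 * θ < 2 * Real.pi) :
    0 < Real.cos (θ / 2) - Real.sin (3 * θ / 4) := by
  rw [← Real.cos_pi_div_two_sub, sub_pos]
  exact Real.cos_lt_cos_of_nonneg_of_le_pi (by linarith) (by linarith) (by linarith)

theorem one_le_ratio {θ : ℝ} (h0 : 0 < θ) (h1 : 5 * θ < 2 * Real.pi) :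
    1 ≤ Real.cos (θ / 4) / (Real.cos (θ / 2) - Real.sin (3 * θ / 4)) := by
  rw [one_le_div (ratio_pos h0 h1)]
  have h2 : Real.cos (θ / 2) ≤ Real.cos (θ / 4) :=
    Real.cos_le_cos_of_nonneg_of_le_pi (by linarith) (by linarith) (by linarith)
  have h3 : 0 < Real.sin (3 * θ / 4) :=
    Real.sin_pos_of_pos_of_lt_pi (by linarith) (by linarith)
  linarith

/-! ### Graph distance and reduction to single edges. -/

theorem walkLength_append {G : SimpleGraph P} {u v w : P} (p : G.Walk u v) (q : G.Walk v w) :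
    walkLength (p.append q) = walkLength p + walkLength q := by
  simp [walkLength]

theorem walkLength_reverse {G : SimpleGraph P} {u v : P} (p : G.Walk u v) :
    walkLength p.reverse = walkLength p := by
  rw [walkLength, walkLength, SimpleGraph.Walk.darts_reverse, List.map_reverse, List.sum_reverse,
    List.map_map]
  congr 2
  funext e
  exact edist_comm _ _

theorem graphDist_triangle (G : SimpleGraph P) (u v w : P) :
    graphDist G u w ≤ graphDist G u v + graphDist G v w := by
  refine ENNReal.le_iInf_add_iInf fun p q => ?_
  rw [← walkLength_append]
  exact iInf_le _ _

theorem graphDist_comm (G : SimpleGraph P) (u v : P) : graphDist G u v = graphDist G v u := by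
  apply le_antisymm <;>
  · refine le_iInf fun p => (iInf_le _ p.reverse).trans_eq (walkLength_reverse p)

theorem graphDist_le_of_adj {G : SimpleGraph P} {u v : P} (h : G.Adj u v) :
    graphDist G u v ≤ ENNReal.ofReal (dist (u : Plane) v) := by
  refine (iInf_le _ h.toWalk).trans_eq ?_
  simp [walkLength, edist_dist]

theorem isSpanner_of_adj {t : ℝ} (ht : 1 ≤ t) {G H : SimpleGraph P} (hHG : H ≤ G)
    (h : ∀ u v, G.Adj u v → graphDist H u v ≤ ENNReal.ofReal (t * dist (u : Plane) v)) :
    IsSpanner t G H := by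
  refine ⟨ht, hHG, fun u v => ?_⟩
  have key : ∀ (a b : P) (p : G.Walk a b), graphDist H a b ≤ ENNReal.ofReal t * walkLength p := by
    intro a b p
    induction p with
    | nil => exact (iInf_le _ SimpleGraph.Walk.nil).trans (by simp [walkLength])
    | @cons a b c hab p ih =>
      refine (graphDist_triangle H a b c).trans ?_
      have e : walkLength (SimpleGraph.Walk.cons hab p) = edist (a : Plane) b + walkLength p := by
        simp [walkLength]
      rw [e, mul_add, edist_dist, ← ENNReal.ofReal_mul (by linarith)]
      exact add_le_add (h a b hab) ih
  rw [graphDist.eq_def G, ENNReal.mul_iInf_of_ne (by simpa using by linarith) ENNReal.ofReal_ne_top]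
  exact le_iInf (key u v)

theorem thetaGraph_le_visGraph (m : ℕ) (S : SimpleGraph P) : thetaGraph m S ≤ visGraph S := by
  intro u v h
  rw [thetaGraph, SimpleGraph.fromRel_adj] at h
  rcases h.2 with ⟨_, _, -, h, -⟩ | ⟨_, _, -, h, -⟩
  · exact h
  · exact h.symm

/-! ### Subcones. -/

theorem side_add (p q v w : Plane) (c d : ℝ) :
    side p q (p + (c • (v - p) + d • (w - p))) = c * side p q v + d * side p q w := by
  simp only [side, PiLp.add_apply, PiLp.smul_apply, PiLp.sub_apply, smul_eq_mul]
  ring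

/-- A subcone is closed under nonnegative combinations. -/
theorem IsSubcone.combo_mem {m : ℕ} {S : SimpleGraph P} {u : P} {i : ℕ} {K : Set Plane}
    (hK : IsSubcone m S u i K) {v w : Plane} (hv : v ∈ K) (hw : w ∈ K) {c d : ℝ} (hc : 0 ≤ c)
    (hd : 0 ≤ d) : (u : Plane) + (c • (v - u) + d • (w - u)) ∈ K := by
  obtain ⟨x, -, -, rfl⟩ := hK
  refine ⟨combo_mem_cone hv.1 hw.1 hc hd, fun z hz hzc => ?_⟩
  rw [side_add]
  have h1 := mul_nonneg hc (hv.2 z hz hzc)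
  have h2 := mul_nonneg hd (hw.2 z hz hzc)
  linarith

theorem IsSubcone.subset_cone {m : ℕ} {S : SimpleGraph P} {u : P} {i : ℕ} {K : Set Plane}
    (hK : IsSubcone m S u i K) : K ⊆ cone m u i := by
  obtain ⟨x, -, -, rfl⟩ := hK
  exact fun y hy => hy.1

/-- No constraint at the apex enters the angle spanned by two points of a subcone. -/
theorem IsSubcone.not_constraint_between {m : ℕ} {S : SimpleGraph P} {u : P} {i : ℕ}
    {K : Set Plane} (hK : IsSubcone m S u i K) {v w : Plane} (hD : side u v w ≠ 0) (hv : v ∈ K)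
    (hw : w ∈ K) (z : P) (hz : S.Adj u z) : ¬ (0 < bary u v w z ∧ 0 < bary u w v z) := by
  rintro ⟨hα, hβ⟩
  have hzK := hK.combo_mem hv hw hα.le hβ.le
  rw [← eq_add_bary hD] at hzK
  have hzc := hK.subset_cone hzK
  obtain ⟨x, -, hx, rfl⟩ := hK
  have h1 := hv.2 z hz hzc
  have h2 := hw.2 z hz hzc
  have h0 := hx z hz hzc
  -- The line `uz` strictly separates `v` from `w`, yet `x`, which is off this line, must be on the
  -- side of both.
  have e1 : side u z v = -(bary u w v z * side u v w) := by
    rw [bary, side_swap (u : Plane) v w]; field_simp [side_swap_ne hD]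
  have e2 : side u z w = bary u v w z * side u v w := by rw [bary]; field_simp
  rw [e1] at h1
  rw [e2] at h2
  have h3 : side u z x * side u v w = 0 := by
    apply le_antisymm
    · by_contra! h
      nlinarith [mul_pos hβ h]
    · by_contra! h
      nlinarith [mul_pos hα (neg_pos.2 h)]
  rcases mul_eq_zero.1 h3 with h | h
  · exact h0 h
  · exact hD h

/-- A point of `P` in the interior of a cone lies in a subcone. -/
theorem exists_subcone {m : ℕ} (hs : 0 < Real.sin (aperture m / 2))
    (hc : 0 < Real.cos (aperture m / 2)) (hN : NoThreeCollinear P) (S : SimpleGraph P) {u w : P}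
    (huw : u ≠ w) {i : ℕ} (hw : |across (i * aperture m) (w - u : Plane)| * Real.cos (aperture m / 2) <
      along (i * aperture m) (w - u : Plane) * Real.sin (aperture m / 2)) :
    ∃ K, IsSubcone m S u i K ∧ (w : Plane) ∈ K := by
  -- If `uw` is a constraint, `w` lies on its line and cannot be the witness; a small shift
  -- perpendicular to `uw` leaves this line and changes no other side.
  set n : Plane := !₂[-((w : Plane) 1 - (u : Plane) 1), (w : Plane) 0 - (u : Plane) 0] with hn
  set f : ℝ → Plane := fun ε => w + ε • n with hf
  have hf0 : f 0 = w := by simp [hf]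
  have hfc : Continuous f := by fun_prop
  have hne : (u : Plane) ≠ w := fun h => huw (Subtype.ext h)
  have hlim : Filter.Tendsto f (nhdsWithin 0 (Set.Ioi 0)) (nhds w) := by
    have := hfc.tendsto 0
    rw [hf0] at this
    exact this.mono_left nhdsWithin_le_nhds
  have ev1 : ∀ᶠ ε in nhdsWithin (0 : ℝ) (Set.Ioi 0), f ε ∈ cone m u i := by
    have hopen : ∀ᶠ y in nhds (w : Plane),
        |across (i * aperture m) (y - u : Plane)| * Real.cos (aperture m / 2) <
        along (i * aperture m) (y - u : Plane) * Real.sin (aperture m / 2) := by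
      apply ContinuousAt.eventually_lt _ _ hw
      · unfold across; fun_prop
      · unfold along; fun_prop
    filter_upwards [hlim.eventually hopen] with ε hε
    exact (mem_cone_iff hs hc _ _ _).2 hε.le
  have ev2 : ∀ᶠ ε in nhdsWithin (0 : ℝ) (Set.Ioi 0), ∀ z : P, z ≠ u → z ≠ w →
      0 < side u z (f ε) * side u z w := by
    rw [Filter.eventually_all]
    intro z
    by_cases hzu : z = u
    · simp [hzu]
    by_cases hzw : z = w
    · simp [hzw]
    have h0 : 0 < side u z w * side u z w :=
      mul_self_pos.2 (hN u z w (Ne.symm hzu) huw hzw)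
    have hopen : ∀ᶠ y in nhds (w : Plane), 0 < side u z y * side u z w := by
      apply ContinuousAt.eventually_lt _ _ h0
      · fun_prop
      · unfold side; fun_prop
    filter_upwards [hlim.eventually hopen] with ε hε _ _ using hε
  have ev3 : ∀ᶠ ε in nhdsWithin (0 : ℝ) (Set.Ioi 0), side u w (f ε) ≠ 0 := by
    filter_upwards [self_mem_nhdsWithin] with ε hε
    have e : side u w (f ε) = ε * dist (u : Plane) w ^ 2 := by
      rw [EuclideanSpace.dist_eq, Real.sq_sqrt (by positivity)]
      simp only [side, hf, hn, Fin.sum_univ_two, PiLp.add_apply, PiLp.smul_apply, smul_eq_mul,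
        Real.dist_eq, sq_abs]
      simp
      ring
    rw [e]
    have : 0 < dist (u : Plane) w := dist_pos.2 hne
    have hε' : 0 < ε := hε
    positivity
  obtain ⟨ε, h1, h2, h3⟩ := (ev1.and (ev2.and ev3)).exists
  refine ⟨_, ⟨f ε, h1, ?_, rfl⟩, ⟨?_, ?_⟩⟩
  · intro z hz _
    by_cases hzw : z = w
    · rwa [hzw]
    · exact fun h => (h2 z hz.ne.symm hzw).ne' (by rw [h, zero_mul])
  · exact (mem_cone_iff hs hc _ _ _).2 hw.le
  · intro z hz _
    by_cases hzw : z = w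
    · simp [hzw]
    · exact (h2 z hz.ne.symm hzw).le

/-! ### Induction on the length of visibility edges. -/

/-- The inductive step: a visibility edge close to the bisector of a cone is approximated, if all
shorter visibility edges are. -/
theorem graphDist_le_step {m : ℕ} (hm : 3 ≤ m) {t : ℝ} (ht : 1 ≤ t)
    (hteq : Real.cos (aperture m / 4) + t * Real.sin (3 * aperture m / 4) =
      t * Real.cos (aperture m / 2))
    (hN : NoThreeCollinear P) {S : SimpleGraph P} (hS : PlanarConstraints S) {u w : P}
    (huw : (visGraph S).Adj u w)
    (ih : ∀ a b : P, (visGraph S).Adj a b → dist (a : Plane) b < dist (u : Plane) w →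
      graphDist (thetaGraph m S) a b ≤ ENNReal.ofReal (t * dist (a : Plane) b))
    (i : Fin m) (hw0 : 0 < along (i * aperture m) (w - u : Plane))
    (hw : |across (i * aperture m) (w - u : Plane)| * Real.cos (aperture m / 4) ≤
      along (i * aperture m) (w - u : Plane) * Real.sin (aperture m / 4)) :
    graphDist (thetaGraph m S) u w ≤ ENNReal.ofReal (t * dist (u : Plane) w) := by
  have hm0 : (0 : ℝ) < m := by exact_mod_cast (by omega : 0 < m)
  have hm3 : (3 : ℝ) ≤ m := by exact_mod_cast hm
  set θ := aperture m with hθ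
  have hmθ : m * θ = 2 * Real.pi := by rw [hθ, aperture]; field_simp
  have hπ := Real.pi_pos
  have hθ0 : 0 < θ := by rw [hθ, aperture]; positivity
  have hθ1 : θ < Real.pi := by nlinarith
  have hs2 : 0 < Real.sin (θ / 2) := Real.sin_pos_of_pos_of_lt_pi (by linarith) (by linarith)
  have hc2 : 0 < Real.cos (θ / 2) := Real.cos_pos_of_mem_Ioo ⟨by linarith, by linarith⟩
  have hs4 : 0 < Real.sin (θ / 4) := Real.sin_pos_of_pos_of_lt_pi (by linarith) (by linarith)
  have hc4 : 0 < Real.cos (θ / 4) := Real.cos_pos_of_mem_Ioo ⟨by linarith, by linarith⟩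
  set φ : ℝ := (i : ℕ) * θ with hφ
  have hwcone : |across φ (w - u : Plane)| * Real.cos (θ / 2) <
      along φ (w - u : Plane) * Real.sin (θ / 2) := by
    have h1 : Real.sin (θ / 4) * Real.cos (θ / 2) < Real.sin (θ / 2) * Real.cos (θ / 4) := by
      have e : Real.sin (θ / 4) = Real.sin (θ / 2 - θ / 4) := by congr 1; ring
      rw [Real.sin_sub] at e
      linarith
    have h2 := mul_le_mul_of_nonneg_right hw hc2.le
    have h3 := mul_lt_mul_of_pos_left h1 hw0
    by_contra! h
    nlinarith [mul_le_mul_of_nonneg_right h hc4.le]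
  obtain ⟨K, hK, hwK⟩ := exists_subcone hs2 hc2 hN S huw.ne hwcone
  classical
  obtain ⟨v, hvA, hvmin⟩ := (Finset.univ.filter fun v : P => (visGraph S).Adj u v ∧
    (v : Plane) ∈ K).exists_min_image (fun v => dist (u : Plane) (bisectorProj m u i v))
    ⟨w, by simp [huw, hwK]⟩
  simp only [Finset.mem_filter, Finset.mem_univ, true_and, and_imp] at hvA hvmin
  obtain ⟨huv, hvK⟩ := hvA
  have huvθ : (thetaGraph m S).Adj u v := by
    rw [thetaGraph, SimpleGraph.fromRel_adj]
    exact ⟨huv.ne, Or.inl ⟨i, K, hK, huv, hvK, hvmin⟩⟩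
  have hcone : ∀ x ∈ K, |across φ (x - u : Plane)| * Real.cos (θ / 2) ≤
      along φ (x - u : Plane) * Real.sin (θ / 2) := fun x hx =>
    (mem_cone_iff hs2 hc2 _ _ _).1 (hK.subset_cone hx)
  have hpos : ∀ x ∈ K, 0 ≤ along φ (x - u : Plane) := by
    intro x hx
    have h1 := hcone x hx
    have h2 := mul_nonneg (abs_nonneg (across φ (x - u : Plane))) hc2.le
    by_contra! h
    nlinarith
  have hvmin' : ∀ x : P, (visGraph S).Adj u x → (x : Plane) ∈ K →
      along φ (v - u : Plane) ≤ along φ (x - u : Plane) := by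
    intro x hx hxK
    have := hvmin x hx hxK
    rwa [dist_bisectorProj, dist_bisectorProj, abs_of_nonneg (hpos v hvK),
      abs_of_nonneg (hpos x hxK)] at this
  have hv0 : 0 < along φ (v - u : Plane) := by
    refine lt_of_le_of_ne (hpos v hvK) fun h => huv.ne ?_
    have h1 := hcone v hvK
    rw [← h, zero_mul] at h1
    have h2 : across φ (v - u : Plane) = 0 := by
      rw [← abs_nonpos_iff]
      by_contra! h3
      nlinarith
    have h4 : (v - u : Plane) = 0 := by
      apply eq_of_along_across (φ := φ)
      · rw [← h]; simp [along]
      · rw [h2]; simp [across]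
    exact Subtype.ext (sub_eq_zero.1 h4).symm
  by_cases hvw : v = w
  · subst hvw
    refine (graphDist_le_of_adj huvθ).trans (ENNReal.ofReal_le_ofReal ?_)
    nlinarith [dist_nonneg (x := (u : Plane)) (y := v)]
  have hD : side u v w ≠ 0 := hN u v w huv.ne huw.ne hvw
  set s : ℝ := along φ (v - u : Plane) / along φ (w - u : Plane) with hs
  have hs0 : 0 < s := by positivity
  have hs1 : s ≤ 1 := (div_le_one hw0).2 (hvmin' w huw hwK)
  set q : Plane := u + s • (w - u : Plane) with hq
  have hstep : dist (u : Plane) v + t * dist (v : Plane) q ≤ t * dist (u : Plane) q := by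
    have := norm_add_mul_norm_le hθ0 hθ1 (by linarith) hteq hv0 hw0 (hcone v hvK) hw
    rw [← hs] at this
    have e : (v : Plane) - u - s • ((w : Plane) - u) = v - q := by rw [hq]; abel
    have e' : q - u = s • ((w : Plane) - u) := by rw [hq]; abel
    rwa [dist_comm (u : Plane) v, dist_comm (u : Plane) q, dist_eq_norm, dist_eq_norm, dist_eq_norm,
      e', ← e]
  have huq : dist (u : Plane) q + dist q w = dist (u : Plane) w := by
    have h1 := dist_lineMap_add (a := (u : Plane)) (b := w) hs0.le
    have h2 := dist_lineMap_add (a := (u : Plane)) (b := w) hs1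
    rw [zero_smul, add_zero] at h1
    rw [one_smul, add_sub_cancel] at h2
    rw [hq, h1, h2]
    ring
  have huv0 : 0 < dist (u : Plane) v := dist_pos.2 fun h => huv.ne (Subtype.ext h)
  have hchain := chain_connected hS hN (t := t) (R := dist (u : Plane) w) (by linarith)
    -- `0 ≤ L` makes `ENNReal.ofReal` additive on the lengths.
    (C := fun a b L => 0 ≤ L ∧ graphDist (thetaGraph m S) a b ≤ ENNReal.ofReal L)
    (by
      rintro a b c L L' ⟨h1, h2⟩ ⟨h3, h4⟩
      refine ⟨by linarith, (graphDist_triangle _ a b c).trans ?_⟩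
      rw [ENNReal.ofReal_add h1 h3]
      exact add_le_add h2 h4)
    (fun a b L L' h h' => ⟨h.1.trans h', h.2.trans (ENNReal.ofReal_le_ofReal h')⟩)
    (fun a b hab h => ⟨by positivity, ih a b hab h⟩)
    huw _ v hD huv (hK.not_constraint_between hD hvK hwK) s hs0 hs1 ?_ (Nat.lt_succ_self _) ?_
  · refine (graphDist_triangle _ u v w).trans
      ((add_le_add (graphDist_le_of_adj huvθ) hchain.2).trans ?_)
    rw [← ENNReal.ofReal_add huv0.le hchain.1]
    apply ENNReal.ofReal_le_ofReal
    rw [← huq, mul_add, mul_add]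
    linarith
  -- Such a `p` lies in `K`, so it projects no closer than `v`; since `vq` is perpendicular to the
  -- bisector, `p` is not below `vq`.
  · intro p hp h1 h2 h3
    have hpK := hK.combo_mem hvK hwK h1 h2
    rw [← eq_add_bary hD] at hpK
    have h4 := hvmin' p hp hpK
    have e : (p : Plane) - u = bary u v w p • (v - u : Plane) + bary u w v p • (w - u : Plane) := by
      rw [sub_eq_iff_eq_add']; exact eq_add_bary hD p
    rw [e, along_combo] at h4
    have e2 : along φ (v - u : Plane) = s * along φ (w - u : Plane) := by rw [hs]; field_simp
    rw [e2, ← mul_assoc, ← mul_comm s, ← add_mul] at h4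
    exact le_of_mul_le_mul_right h4 hw0
  -- As |uv| > 0, `hstep` gives |vq| < |uq|, so all links are shorter than `uw`.
  · rw [← huq]
    have : dist (v : Plane) q < dist (u : Plane) q := by
      by_contra! h
      nlinarith [mul_le_mul_of_nonneg_left h (by linarith : 0 ≤ t)]
    linarith

/-- A shortest counterexample exists because `P` is finite; symmetry of the distances allows its
ends to be swapped. -/
theorem graphDist_le_of_visible {m : ℕ} (hodd : Odd m) (hm : 3 ≤ m) {t : ℝ} (ht : 1 ≤ t)
    (hteq : Real.cos (aperture m / 4) + t * Real.sin (3 * aperture m / 4) =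
      t * Real.cos (aperture m / 2))
    (hN : NoThreeCollinear P) {S : SimpleGraph P} (hS : PlanarConstraints S) (u w : P)
    (huw : (visGraph S).Adj u w) :
    graphDist (thetaGraph m S) u w ≤ ENNReal.ofReal (t * dist (u : Plane) w) := by
  by_contra hbad
  obtain ⟨⟨u, w⟩, ⟨huw, hbad⟩, hmin⟩ := Set.exists_min_image
    {x : P × P | (visGraph S).Adj x.1 x.2 ∧ ¬ graphDist (thetaGraph m S) x.1 x.2 ≤
      ENNReal.ofReal (t * dist (x.1 : Plane) x.2)}
    (fun x => dist (x.1 : Plane) x.2) (Set.toFinite _) ⟨(u, w), huw, hbad⟩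
  simp only at huw hbad hmin
  have ih : ∀ a b : P, (visGraph S).Adj a b → dist (a : Plane) b < dist (u : Plane) w →
      graphDist (thetaGraph m S) a b ≤ ENNReal.ofReal (t * dist (a : Plane) b) := by
    intro a b hab hlt
    by_contra h
    exact absurd (hmin (a, b) ⟨hab, h⟩) (not_le.2 hlt)
  have hne : (u : Plane) ≠ w := fun h => huw.ne (Subtype.ext h)
  obtain ⟨i, ⟨h1, h2⟩ | ⟨h1, h2⟩⟩ := exists_cone_near_bisector hodd hm hne
  · exact hbad (graphDist_le_step hm ht hteq hN hS huw ih i h1 h2)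
  · rw [dist_comm] at ih
    rw [graphDist_comm, dist_comm] at hbad
    exact hbad (graphDist_le_step hm ht hteq hN hS huw.symm ih i h1 h2)

end ConstrainedTheta

theorem mainTheorem6 (k m : ℕ) (hk : 1 ≤ k) (hm : m = 4 * k + 3 ∨ m = 4 * k + 5)
    (θ : ℝ) (hθ : θ = 2 * Real.pi / m)
    (P : Finset ConstrainedTheta.Plane) (hP : ConstrainedTheta.GeneralPosition m P)
    (S : SimpleGraph P) (hS : ConstrainedTheta.PlanarConstraints S) :
    ConstrainedTheta.IsSpanner
      (Real.cos (θ / 4) / (Real.cos (θ / 2) - Real.sin (3 * θ / 4)))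
      (ConstrainedTheta.visGraph S) (ConstrainedTheta.thetaGraph m S) := by
  have hm7 : 7 ≤ m := by omega
  have hodd : Odd m := by
    rcases hm with rfl | rfl
    · exact ⟨2 * k + 1, by ring⟩
    · exact ⟨2 * k + 2, by ring⟩
  have hm7' : (7 : ℝ) ≤ m := by exact_mod_cast hm7
  have hπ := Real.pi_pos
  have hmθ : m * θ = 2 * Real.pi := by rw [hθ]; field_simp
  have hθ0 : 0 < θ := by rw [hθ]; positivity
  have hθ1 : 5 * θ < 2 * Real.pi := by nlinarith
  have hden := ConstrainedTheta.ratio_pos hθ0 hθ1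
  have ht := ConstrainedTheta.one_le_ratio hθ0 hθ1
  refine ConstrainedTheta.isSpanner_of_adj ht (ConstrainedTheta.thetaGraph_le_visGraph m S)
    (ConstrainedTheta.graphDist_le_of_visible hodd (by omega) ht ?_ hP.noThreeCollinear hS)
  rw [show ConstrainedTheta.aperture m = θ from hθ.symm]
  linear_combination -(div_mul_cancel₀ (Real.cos (θ / 4)) hden.ne')
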